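/- Fix an algebraic signature (finitary operation symbols only). For an algebra $A$ let $\mathrm{Con}(A)$ be its lattice of congruences, with top $1_A$ (the total relation) and bottom $0_A$ (equality). For $\alpha,\beta\in\mathrm{Con}(A)$ let $M(\alpha,\beta)$ be the subalgebra of $A^4$, written as $2\times 2$ matrices, generated by all $\begin{pmatrix}a&a\\a'&a'\end{pmatrix}$ with $a\,\alpha\,a'$ and all $\begin{pmatrix}b&b'\\b&b'\end{pmatrix}$ with $b\,\beta\,b'$. For $\delta\in\mathrm{Con}(A)$, $\alpha$ centralizes $\beta$ modulo $\delta$, written $C(\alpha,\beta;\delta)$, if for every $\begin{pmatrix}p&q\\r&s\end{pmatrix}\in M(\alpha,\beta)$, $p\,\delta\,q$ implies $r\,\delta\,s$. The commutator is $[\alpha,\beta]=\bigwedge\{\delta\in\mathrm{Con}(A): C(\alpha,\beta;\delta)\}$, and $A$ is Abelian if $[1_A,1_A]=0_A$. A variety is a class of algebras of the given signature closed under homomorphic images, subalgebras and arbitrary direct products; it is congruence modular if $\mathrm{Con}(A)$ is a modular lattice for each of its members $A$. **Theorem.** Let $\mathcal V$ be a congruence modular variety. 1. If $A\in\mathcal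 V$ is Abelian and $f:A\to B$ is a surjective homomorphism, then $B$ is Abelian. 2. If $A\in\mathcal V$ is Abelian, then every subalgebra of $A$ is Abelian. 3. If $(A_i)_{i\in I}$ is any family of Abelian algebras in $\mathcal V$, then $\prod_{i\in I}A_i$ is Abelian. Hence the class of Abelian algebras in $\mathcal V$ is a subvariety of $\mathcal V$, that is, a variety contained in $\mathcal V$. -/

import Mathlib

open scoped FirstOrder

universe u v w

namespace UniversalAlgebra

open FirstOrder.Language.Structure

/-- The direct product of a family of structures, with coordinatewise operations. -/
instance piStructure {L : FirstOrder.Language.{u, v}} {I : Type*} (A : I → Type*)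
    [∀ i, L.Structure (A i)] : L.Structure (∀ i, A i) where
  funMap f x := fun i => funMap f fun k => x k i
  RelMap r x := ∀ i, RelMap r fun k => x k i

/-- A congruence on `A`: an equivalence relation compatible with all fundamental operations. -/
structure Congruence (L : FirstOrder.Language.{u, v}) (A : Type w) [L.Structure A] extends Setoid A where
  funMap_rel' : ∀ {n : ℕ} (f : L.Functions n) (x y : Fin n → A),
    (∀ i, r (x i) (y i)) → r (funMap f x) (funMap f y)

namespace Congruence

variable {L : FirstOrder.Language.{u, v}} {A : Type w} [L.Structure A]

theorem toSetoid_injective :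
    Function.Injective (Congruence.toSetoid : Congruence L A → Setoid A) := by
  rintro ⟨s, hs⟩ ⟨t, ht⟩ h
  cases h
  rfl

/-- Congruences are ordered by inclusion. -/
instance : PartialOrder (Congruence L A) :=
  PartialOrder.lift Congruence.toSetoid toSetoid_injective

/-- The meet of a set of congruences is their intersection. -/
instance : InfSet (Congruence L A) where
  sInf S :=
    { r := fun a b => ∀ θ ∈ S, θ.r a b
      iseqv :=
        ⟨fun a θ _ => θ.iseqv.refl a, fun h θ hθ => θ.iseqv.symm (h θ hθ),
          fun h h' θ hθ => θ.iseqv.trans (h θ hθ) (h' θ hθ)⟩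
      funMap_rel' := fun f x y h θ hθ => θ.funMap_rel' f x y fun i => h i θ hθ }

/-- The complete lattice `Con(A)`; its top `1_A` is the total relation, its bottom `0_A` is
equality, and binary meet is intersection. -/
instance : CompleteLattice (Congruence L A) :=
  { completeLatticeOfInf (Congruence L A) fun _ =>
      ⟨fun θ hθ _ _ h => h θ hθ, fun _ hψ _ _ h _ hθ => hψ hθ h⟩ with
    inf := fun θ ψ =>
      { r := fun a b => θ.r a b ∧ ψ.r a b
        iseqv :=
          ⟨fun a => ⟨θ.iseqv.refl a, ψ.iseqv.refl a⟩,
            fun h => ⟨θ.iseqv.symm h.1, ψ.iseqv.symm h.2⟩,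
            fun h h' => ⟨θ.iseqv.trans h.1 h'.1, ψ.iseqv.trans h.2 h'.2⟩⟩
        funMap_rel' := fun f x y h =>
          ⟨θ.funMap_rel' f x y fun i => (h i).1, ψ.funMap_rel' f x y fun i => (h i).2⟩ }
    inf_le_left := fun _ _ _ _ h => h.1
    inf_le_right := fun _ _ _ _ h => h.2
    le_inf := fun _ _ _ h h' _ _ hab => ⟨h hab, h' hab⟩
    top :=
      { r := fun _ _ => True
        iseqv := ⟨fun _ => trivial, fun _ => trivial, fun _ _ => trivial⟩
        funMap_rel' := fun _ _ _ _ => trivial }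
    le_top := fun _ _ _ _ => trivial
    bot :=
      { r := fun a b => a = b
        iseqv := ⟨fun _ => rfl, fun h => h.symm, fun h h' => h.trans h'⟩
        funMap_rel' := fun f _ _ h => congrArg (funMap f) (funext h) }
    bot_le := fun θ a _ h => h ▸ θ.iseqv.refl a }

/-- The subalgebra `M(α, β)` of `A⁴` (written as `2 × 2` matrices, given by their rows)
generated by the matrices with rows `(a, a), (a', a')` for `a α a'` and the matrices with rows
`(b, b'), (b, b')` for `b β b'`. -/
def matrices (α β : Congruence L A) : L.Substructure (Fin 2 → Fin 2 → A) :=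
  FirstOrder.Language.Substructure.closure L
    ({m | ∃ a a' : A, α.r a a' ∧ m = ![ ![a, a], ![a', a'] ]} ∪
      {m | ∃ b b' : A, β.r b b' ∧ m = ![ ![b, b'], ![b, b'] ]})

/-- The term condition `C(α, β; δ)`: `α` centralizes `β` modulo `δ`. -/
def Centralizes (α β δ : Congruence L A) : Prop :=
  ∀ m ∈ matrices α β, δ.r (m 0 0) (m 0 1) → δ.r (m 1 0) (m 1 1)

/-- The commutator `[α, β]`: the meet of all `δ` such that `α` centralizes `β` modulo `δ`. -/
def commutator (α β : Congruence L A) : Congruence L A :=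
  sInf {δ | Centralizes α β δ}

end Congruence

/-- `A` is Abelian if `[1_A, 1_A] = 0_A`. -/
def IsAbelian (L : FirstOrder.Language.{u, v}) (A : Type w) [L.Structure A] : Prop :=
  Congruence.commutator (⊤ : Congruence L A) ⊤ = ⊥

/-- A class of algebras of the same type is a variety if it is closed under homomorphic images,
subalgebras and arbitrary direct products (the empty product included). Closure is required
only for subalgebras with nonempty carrier, so that the usual convention that algebras are
nonempty and the convention that admits an empty algebra are both covered. -/
structure IsVariety {L : FirstOrder.Language.{u, v}} (V : Set (CategoryTheory.Bundled.{w} L.Structure)) : Prop where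
  homImage_mem : ∀ A ∈ V, ∀ (B : CategoryTheory.Bundled.{w} L.Structure) (f : A →[L] B),
    Function.Surjective f → B ∈ V
  subalgebra_mem : ∀ A ∈ V, ∀ S : L.Substructure A, Nonempty S → CategoryTheory.Bundled.of (c := L.Structure) S ∈ V
  pi_mem : ∀ (I : Type w) (A : I → CategoryTheory.Bundled.{w} L.Structure), (∀ i, A i ∈ V) →
    CategoryTheory.Bundled.of (c := L.Structure) (∀ i, A i) ∈ V

/-- A class of algebras is congruence modular if every member has a modular congruence lattice. -/
def IsCongruenceModular {L : FirstOrder.Language.{u, v}} (V : Set (CategoryTheory.Bundled.{w} L.Structure)) : Prop :=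
  ∀ A ∈ V, IsModularLattice (Congruence L A)

/-- `W` is a subvariety of `V`: a variety all of whose members belong to `V`. -/
def IsSubvariety {L : FirstOrder.Language.{u, v}} (W V : Set (CategoryTheory.Bundled.{w} L.Structure)) : Prop :=
  IsVariety W ∧ W ⊆ V

end UniversalAlgebra

namespace UniversalAlgebra

open FirstOrder.Language FirstOrder.Language.Structure

namespace Congruence

section Basic

variable {L : FirstOrder.Language.{u, v}} {A : Type w} [L.Structure A]

/-! The term condition `C(1, 1; 0)` forbids equal top entries over distinct bottom ones in `M(1,
1)`, so it is inherited by subalgebras and products without modularity. Quotients need `C(1, 1; θ)`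
for the kernel `θ` of the map, and this is where modularity enters (`centralizes_of_isAbelian`). It
is applied not in `Con(A)` but in the congruence lattice of `M(1, 1)`, which lies in the variety as
a subalgebra of a power of `A`. Matrices over the image lift to matrices over `A`, so `C(1, 1; θ)`
gives `C(1, 1; 0)` below. -/

theorem centralizes_sInf (α β : Congruence L A) (S : Set (Congruence L A))
    (hS : ∀ δ ∈ S, Centralizes α β δ) : Centralizes α β (sInf S) :=
  fun m hm h δ hδ => hS δ hδ m hm (h δ hδ)

theorem isAbelian_iff_centralizes :
    IsAbelian L A ↔ Centralizes (⊤ : Congruence L A) ⊤ ⊥ := by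
  constructor
  · intro h
    have := centralizes_sInf (⊤ : Congruence L A) ⊤ {δ | Centralizes ⊤ ⊤ δ} fun _ hδ => hδ
    rwa [show sInf {δ | Centralizes (⊤ : Congruence L A) ⊤ δ} = ⊥ from h] at this
  · intro h
    exact le_bot_iff.1 (sInf_le h)

/-- The term condition `C(1, 1; 0)` spelled out. -/
theorem isAbelian_iff :
    IsAbelian L A ↔ ∀ m ∈ matrices (⊤ : Congruence L A) ⊤, m 0 0 = m 0 1 → m 1 0 = m 1 1 :=
  isAbelian_iff_centralizes

theorem row_const_mem (a a' : A) : ![ ![a, a], ![a', a'] ] ∈ matrices (⊤ : Congruence L A) ⊤ :=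
  Substructure.subset_closure (Or.inl ⟨a, a', trivial, rfl⟩)

theorem col_const_mem (b b' : A) : ![ ![b, b'], ![b, b'] ] ∈ matrices (⊤ : Congruence L A) ⊤ :=
  Substructure.subset_closure (Or.inr ⟨b, b', trivial, rfl⟩)

/-- Transposition swaps the two kinds of generators. It lets the term condition be read on columns.
-/
theorem transpose_mem {m : Fin 2 → Fin 2 → A} (hm : m ∈ matrices (⊤ : Congruence L A) ⊤) :
    (fun i j => m j i) ∈ matrices (⊤ : Congruence L A) ⊤ := by
  refine Substructure.closure_induction
    (p := fun m => (fun i j => m j i) ∈ matrices (⊤ : Congruence L A) ⊤) hm ?_ ?_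
  · rintro _ (⟨a, a', -, rfl⟩ | ⟨a, a', -, rfl⟩)
    · convert col_const_mem (L := L) a a' using 1
      ext i j; fin_cases i <;> fin_cases j <;> rfl
    · convert row_const_mem (L := L) a a' using 1
      ext i j; fin_cases i <;> fin_cases j <;> rfl
  · intro n f x hx
    exact (matrices (⊤ : Congruence L A) ⊤).fun_mem f (fun k i j => x k j i) hx

/-- The transitive closure of a reflexive compatible relation is compatible. -/
theorem reflTransGen_funMap {R : A → A → Prop} (hrefl : ∀ a, R a a)
    (hR : ∀ {n : ℕ} (f : L.Functions n) (x y : Fin n → A),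
      (∀ i, R (x i) (y i)) → R (funMap f x) (funMap f y))
    {n : ℕ} (f : L.Functions n) (x y : Fin n → A)
    (h : ∀ i, Relation.ReflTransGen R (x i) (y i)) :
    Relation.ReflTransGen R (funMap f x) (funMap f y) := by
  classical
  -- Arguments are replaced one coordinate at a time, since the chains may have different lengths.
  have key : ∀ s : Finset (Fin n),
      Relation.ReflTransGen R (funMap f x) (funMap f (s.piecewise y x)) := by
    intro s
    induction s using Finset.induction_on with
    | empty => simpa using Relation.ReflTransGen.refl
    | insert i s hi ih =>
      refine ih.trans ?_
      have h1 : s.piecewise y x = Function.update (s.piecewise y x) i (x i) := by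
        rw [eq_comm, Function.update_eq_self_iff]; simp [hi]
      rw [Finset.piecewise_insert]
      nth_rewrite 1 [h1]
      refine Relation.ReflTransGen.lift (fun a => funMap f (Function.update (s.piecewise y x) i a))
        (fun a b hab => hR f _ _ fun j => ?_) _ _ (h i)
      by_cases hj : j = i
      · subst hj; simpa using hab
      · simpa [hj] using hrefl _
  simpa using key Finset.univ

theorem reflTransGen_of_sup (θ ψ : Congruence L A) {a b : A} (h : (θ ⊔ ψ).r a b) :
    Relation.ReflTransGen (fun a b => ∃ c, θ.r a c ∧ ψ.r c b) a b := by
  let R : A → A → Prop := fun a b => ∃ c, θ.r a c ∧ ψ.r c b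
  have hθ : ∀ {a b}, θ.r a b → R a b := fun {a b} h => ⟨b, h, ψ.iseqv.refl b⟩
  have hψ : ∀ {a b}, ψ.r a b → R a b := fun {a b} h => ⟨a, θ.iseqv.refl a, h⟩
  -- `R` need not be symmetric: a reversed step is `ψ` then `θ`, which takes two `R`-steps.
  have hsymm : ∀ {a b}, R a b → Relation.ReflTransGen R b a := fun ⟨c, h1, h2⟩ =>
    (Relation.ReflTransGen.single (hψ (ψ.iseqv.symm h2))).tail (hθ (θ.iseqv.symm h1))
  have hfun : ∀ {n : ℕ} (f : L.Functions n) (x y : Fin n → A),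
      (∀ i, R (x i) (y i)) → R (funMap f x) (funMap f y) := fun f x y h => by
    choose z hz using h
    exact ⟨funMap f z, θ.funMap_rel' f x z fun i => (hz i).1, ψ.funMap_rel' f z y fun i => (hz i).2⟩
  let J : Congruence L A :=
    { r := Relation.ReflTransGen R
      iseqv := ⟨fun _ => .refl, fun h => by
        induction h with
        | refl => exact .refl
        | tail _ h ih => exact (hsymm h).trans ih, fun h h' => h.trans h'⟩
      funMap_rel' := reflTransGen_funMap (fun a => hθ (θ.iseqv.refl a)) hfun }
  have hle : θ ⊔ ψ ≤ J :=
    sup_le (fun _ _ h => .single (hθ h)) (fun _ _ h => .single (hψ h))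
  exact hle h

/-- The inverse image of a congruence under an operation-preserving map. -/
def comap {B : Type*} [L.Structure B] (g : B → A)
    (hg : ∀ {n : ℕ} (f : L.Functions n) (x : Fin n → B), g (funMap f x) = funMap f (g ∘ x))
    (θ : Congruence L A) : Congruence L B where
  r a b := θ.r (g a) (g b)
  iseqv := ⟨fun _ => θ.iseqv.refl _, fun h => θ.iseqv.symm h, fun h h' => θ.iseqv.trans h h'⟩
  funMap_rel' f x y h := by
    rw [hg, hg]
    exact θ.funMap_rel' f _ _ h

/-- The congruence on `M(1, 1)` induced by a congruence on `A` through one matrix entry. -/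
def entry (θ : Congruence L A) (i j : Fin 2) :
    Congruence L (matrices (⊤ : Congruence L A) ⊤) :=
  comap (fun m => m.1 i j) (fun _ _ => rfl) θ

/-- If `M(1, 1)` has modular congruence lattice and `A` is Abelian, then `1` centralizes `1`
modulo every congruence. -/
theorem centralizes_of_isAbelian
    [IsModularLattice (Congruence L (matrices (⊤ : Congruence L A) ⊤))]
    (hA : IsAbelian L A) (θ : Congruence L A) : Centralizes (⊤ : Congruence L A) ⊤ θ := by
  intro m hm hpq
  let M := matrices (⊤ : Congruence L A) ⊤
  -- With `m = (p q; r s)`: `x = (r r; r r)`, `y = (p p; r r)`, `z = m`, `u = (r s; r s)`. Here `α`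
  -- is equality of left columns and `β` equality of bottom rows.
  let x : M := ⟨_, col_const_mem (m 1 0) (m 1 0)⟩
  let y : M := ⟨_, row_const_mem (m 0 0) (m 1 0)⟩
  let z : M := ⟨m, hm⟩
  let u : M := ⟨_, col_const_mem (m 1 0) (m 1 1)⟩
  let e : Fin 2 → Fin 2 → Congruence L M := entry ⊥
  let α : Congruence L M := e 0 0 ⊓ e 1 0
  let β : Congruence L M := e 1 0 ⊓ e 1 1
  let γ : Congruence L M := α ⊓ entry θ 0 1
  have hxy : β.r x y := ⟨rfl, rfl⟩
  have hyz : γ.r y z := ⟨⟨rfl, rfl⟩, hpq⟩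
  have hzu : β.r z u := ⟨rfl, rfl⟩
  have hxu : α.r x u := ⟨rfl, rfl⟩
  have hβ : β ≤ γ ⊔ β := le_sup_right
  have hγ : γ ≤ γ ⊔ β := le_sup_left
  have hj : (γ ⊔ β).r x u :=
    (γ ⊔ β).iseqv.trans (hβ hxy) ((γ ⊔ β).iseqv.trans (hγ hyz) (hβ hzu))
  -- The modular law applies because `γ ≤ α`; it yields a chain from `x` to `u` that never leaves
  -- the `α`-class of `x`.
  have hmod : (γ ⊔ β) ⊓ α ≤ γ ⊔ β ⊓ α := IsModularLattice.sup_inf_le_assoc_of_le β inf_le_left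
  have hchain := reflTransGen_of_sup _ _ (hmod (show ((γ ⊔ β) ⊓ α).r x u from ⟨hj, hxu⟩))
  -- In this class the left column is `(r, r)`, so Abelianness makes the right column constant.
  -- Hence `γ`, which controls the upper right entry modulo `θ`, also controls the lower right one.
  have hcol : ∀ w : M, α.r x w → w.1 0 1 = w.1 1 1 := fun w hw =>
    isAbelian_iff.1 hA _ (transpose_mem w.2) (hw.1.symm.trans hw.2)
  have key : ∀ w : M, Relation.ReflTransGen (fun a b => ∃ c, γ.r a c ∧ (β ⊓ α).r c b) x w →
      α.r x w ∧ θ.r (m 1 0) (w.1 1 1) := by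
    intro w hw
    induction hw with
    | refl => exact ⟨α.iseqv.refl x, θ.iseqv.refl _⟩
    | @tail b c _ h ih =>
      obtain ⟨d, hbd, hdc⟩ := h
      have hxd := α.iseqv.trans ih.1 hbd.1
      refine ⟨α.iseqv.trans hxd hdc.2, θ.iseqv.trans ih.2 ?_⟩
      have h1 : θ.r (b.1 0 1) (d.1 0 1) := hbd.2
      have h2 : d.1 1 1 = c.1 1 1 := hdc.1.2
      rwa [hcol b ih.1, hcol d hxd, h2] at h1
  exact (key u hchain).2

end Basic

section Maps

variable {L : FirstOrder.Language.{u, v}} {A : Type*} {B : Type*} [L.Structure A] [L.Structure B]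

theorem map_mem_matrices (g : A → B)
    (hg : ∀ {n : ℕ} (f : L.Functions n) (x : Fin n → A), g (funMap f x) = funMap f (g ∘ x))
    {m : Fin 2 → Fin 2 → A} (hm : m ∈ matrices (⊤ : Congruence L A) ⊤) :
    (fun i j => g (m i j)) ∈ matrices (⊤ : Congruence L B) ⊤ := by
  refine Substructure.closure_induction
    (p := fun m => (fun i j => g (m i j)) ∈ matrices (⊤ : Congruence L B) ⊤) hm ?_ ?_
  · rintro _ (⟨a, a', -, rfl⟩ | ⟨a, a', -, rfl⟩)
    · convert row_const_mem (L := L) (g a) (g a') using 1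
      ext i j; fin_cases i <;> fin_cases j <;> rfl
    · convert col_const_mem (L := L) (g a) (g a') using 1
      ext i j; fin_cases i <;> fin_cases j <;> rfl
  · intro n f x hx
    have h := (matrices (⊤ : Congruence L B) ⊤).fun_mem f (fun k i j => g (x k i j)) hx
    rwa [show funMap f (fun k i j => g (x k i j)) = fun i j => g (funMap f x i j) from
      funext fun i => funext fun j => (hg f _).symm] at h

/-- Generators lift entrywise, because over the total congruence any pair of preimages is
admissible. -/
theorem exists_matrix_lift (g : A → B)
    (hg : ∀ {n : ℕ} (f : L.Functions n) (x : Fin n → A), g (funMap f x) = funMap f (g ∘ x))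
    (hsurj : Function.Surjective g)
    {m : Fin 2 → Fin 2 → B} (hm : m ∈ matrices (⊤ : Congruence L B) ⊤) :
    ∃ m' ∈ matrices (⊤ : Congruence L A) ⊤, ∀ i j, g (m' i j) = m i j := by
  refine Substructure.closure_induction
    (p := fun m => ∃ m' ∈ matrices (⊤ : Congruence L A) ⊤, ∀ i j, g (m' i j) = m i j) hm ?_ ?_
  · rintro _ (⟨b, b', -, rfl⟩ | ⟨b, b', -, rfl⟩) <;>
      obtain ⟨a, rfl⟩ := hsurj b <;> obtain ⟨a', rfl⟩ := hsurj b'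
    · refine ⟨_, row_const_mem a a', fun i j => ?_⟩
      fin_cases i <;> fin_cases j <;> rfl
    · refine ⟨_, col_const_mem a a', fun i j => ?_⟩
      fin_cases i <;> fin_cases j <;> rfl
  · intro n f x hx
    choose x' hx' hgx using hx
    refine ⟨_, (matrices (⊤ : Congruence L A) ⊤).fun_mem f x' hx', fun i j => ?_⟩
    refine (hg f _).trans (congrArg (funMap f) (funext fun k => hgx k i j))

end Maps

end Congruence

open Congruence

theorem IsAbelian.of_injective {L : FirstOrder.Language.{u, v}} {A : Type*} {B : Type*}
    [L.Structure A] [L.Structure B] (hB : IsAbelian L B) (g : A → B)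
    (hg : ∀ {n : ℕ} (f : L.Functions n) (x : Fin n → A), g (funMap f x) = funMap f (g ∘ x))
    (hinj : Function.Injective g) : IsAbelian L A :=
  isAbelian_iff.2 fun _ hm h =>
    hinj (isAbelian_iff.1 hB _ (map_mem_matrices g hg hm) (congrArg g h))

theorem IsAbelian.pi {L : FirstOrder.Language.{u, v}} {I : Type*} {A : I → Type*}
    [∀ i, L.Structure (A i)] (hA : ∀ i, IsAbelian L (A i)) : IsAbelian L (∀ i, A i) :=
  isAbelian_iff.2 fun _ hm h => funext fun i =>
    isAbelian_iff.1 (hA i) _ (map_mem_matrices (fun a : ∀ i, A i => a i) (fun _ _ => rfl) hm)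
      (congrFun h i)

theorem IsAbelian.of_surjective {L : FirstOrder.Language.{u, v}} {A : Type*} {B : Type*}
    [L.Structure A] [L.Structure B]
    [IsModularLattice (Congruence L (matrices (⊤ : Congruence L A) ⊤))]
    (hA : IsAbelian L A) (g : A → B)
    (hg : ∀ {n : ℕ} (f : L.Functions n) (x : Fin n → A), g (funMap f x) = funMap f (g ∘ x))
    (hsurj : Function.Surjective g) : IsAbelian L B := by
  refine isAbelian_iff.2 fun m hm h => ?_
  obtain ⟨m', hm', hgm⟩ := exists_matrix_lift g hg hsurj hm
  -- `comap g hg ⊥` is the kernel of `g`.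
  have := centralizes_of_isAbelian hA (comap g hg ⊥) m' hm'
    (show g (m' 0 0) = g (m' 0 1) by rw [hgm, hgm, h])
  rw [← hgm, ← hgm]
  exact this

/-- Index sets of products live in `Type w`, hence the detour through `ULift` and a reindexing map.
-/
theorem IsVariety.pow_mem {L : FirstOrder.Language.{u, v}} [L.IsAlgebraic]
    {V : Set (CategoryTheory.Bundled.{w} L.Structure)} (hV : IsVariety V)
    (A : Type w) [L.Structure A] (hA : CategoryTheory.Bundled.of (c := L.Structure) A ∈ V) :
    CategoryTheory.Bundled.of (c := L.Structure) (Fin 2 → A) ∈ V :=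
  hV.homImage_mem _
    (hV.pi_mem (ULift.{w} (Fin 2)) (fun _ => CategoryTheory.Bundled.of (c := L.Structure) A)
      fun _ => hA)
    (CategoryTheory.Bundled.of (c := L.Structure) (Fin 2 → A))
    { toFun := fun x i => x ⟨i⟩
      map_fun' := fun _ _ => rfl
      map_rel' := fun r => isEmptyElim r }
    fun y => ⟨fun i => y i.down, rfl⟩

theorem IsVariety.matrices_modular {L : FirstOrder.Language.{u, v}} [L.IsAlgebraic]
    {V : Set (CategoryTheory.Bundled.{w} L.Structure)} (hV : IsVariety V)
    (hmod : IsCongruenceModular V) (A : Type w) [L.Structure A] [Nonempty A]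
    (hA : CategoryTheory.Bundled.of (c := L.Structure) A ∈ V) :
    IsModularLattice (Congruence L (matrices (⊤ : Congruence L A) ⊤)) :=
  hmod _ (hV.subalgebra_mem _ (hV.pow_mem _ (hV.pow_mem A hA)) (matrices ⊤ ⊤)
    ⟨_, row_const_mem (Classical.arbitrary A) (Classical.arbitrary A)⟩)

end UniversalAlgebra

open UniversalAlgebra in
theorem mainTheorem11 {L : FirstOrder.Language.{u, v}} [L.IsAlgebraic]
    (V : Set (CategoryTheory.Bundled.{max u w} L.Structure))
    (hV : UniversalAlgebra.IsVariety V) (hmod : UniversalAlgebra.IsCongruenceModular V) :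
    (∀ A ∈ V, UniversalAlgebra.IsAbelian L A →
      ∀ (B : CategoryTheory.Bundled.{max u w} L.Structure) (f : A →[L] B), Function.Surjective f →
        UniversalAlgebra.IsAbelian L B) ∧
    (∀ A ∈ V, UniversalAlgebra.IsAbelian L A →
      ∀ S : L.Substructure A, UniversalAlgebra.IsAbelian L S) ∧
    (∀ (I : Type (max u w)) (A : I → CategoryTheory.Bundled.{max u w} L.Structure),
      (∀ i, A i ∈ V) → (∀ i, UniversalAlgebra.IsAbelian L (A i)) →
        UniversalAlgebra.IsAbelian L (∀ i, A i)) ∧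
    UniversalAlgebra.IsSubvariety {A ∈ V | UniversalAlgebra.IsAbelian L A} V := by
  have H : ∀ A ∈ V, IsAbelian L A → ∀ (B : CategoryTheory.Bundled.{max u w} L.Structure)
      (f : A →[L] B), Function.Surjective f → IsAbelian L B := by
    intro A hA hab B f hf
    -- Subalgebra closure covers only nonempty carriers, so an empty `A`, whose image is empty, is
    -- treated apart.
    cases isEmpty_or_nonempty A with
    | inl hemp => exact Congruence.isAbelian_iff.2 fun m _ _ => hemp.elim (hf (m 0 0)).choose
    | inr hne =>
      have := hV.matrices_modular hmod A hA
      exact hab.of_surjective f (fun g x => f.map_fun g x) hf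
  have S : ∀ A ∈ V, IsAbelian L A → ∀ S : L.Substructure A, IsAbelian L S :=
    fun A _ hab S => hab.of_injective (fun s : S => (s : A)) (fun _ _ => rfl) Subtype.val_injective
  refine ⟨H, S, fun I A _ hab => IsAbelian.pi hab, ⟨?_, ?_, ?_⟩, fun A hA => hA.1⟩
  · exact fun A hA B f hf => ⟨hV.homImage_mem A hA.1 B f hf, H A hA.1 hA.2 B f hf⟩
  · exact fun A hA T hT => ⟨hV.subalgebra_mem A hA.1 T hT, S A hA.1 hA.2 T⟩
  · exact fun I A hA => ⟨hV.pi_mem I A fun i => (hA i).1, IsAbelian.pi fun i => (hA i).2⟩
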